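/- **Theorem (Multidimensional Cauchy's Theorem).** Let $N \ge 0$ and let $\Omega \subset \mathbb C^N$ be a compact oriented embedded submanifold of class $C^2$ (for instance, smooth), of real dimension $N+1$, with (possibly empty) boundary and corners; let $\partial\Omega$ carry the boundary orientation. Let $f$ be holomorphic on $\Omega$, that is, complex differentiable on some open subset of $\mathbb C^N$ that contains $\Omega$. Then $$\oint_{\partial\Omega} f(z)\, dz_1\wedge\cdots\wedge dz_N = 0 .$$ Here the integral of an $N$-form $\omega$ over $\partial\Omega$ is $\sum_i \int_{\partial\Omega} \rho_i\,\omega$ for a smooth partition of unity $(\rho_i)$ on $\Omega$ subordinate to finitely many positively oriented local parametrizations $\varphi_i : U_i\cap[0,\infty)^{N+1}\to\Omega$, where $\int_{\partial\Omega}\rho_i\,\omega$ is the sum of the integrals of $\varphi_i^*(\rho_i\omega)$ over the faces $\{x_k=0\}$ of $U_i\cap[0,\infty)^{N+1}$ with the boundary orientation (outward normal first). Such a partition of unity exists, and the sum vanishes for every choice of it. -/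

import Mathlib

open scoped Manifold

/-- The closed quadrant `[0, ∞)ⁿ` in `ℝⁿ`, the local model of a manifold with corners. -/
def quadrant (n : ℕ) : Set (Fin n → ℝ) := {x | ∀ i, 0 ≤ x i}

/-- A local parametrization of class `C²`, with corners, of an `(N+1)`-dimensional subset `Ω` of
`ℂ^N`: a `C²` map defined on an open set `U` of `ℝ^(N+1)`, immersive at the points of
`U ∩ [0, ∞)^(N+1)`, which restricts to a homeomorphism from `U ∩ [0, ∞)^(N+1)` onto a relatively
open subset of `Ω`. -/
structure CornerChart {N : ℕ} (Ω : Set (Fin N → ℂ)) where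
  /-- the open set `U` -/
  source : Set (Fin (N + 1) → ℝ)
  /-- the parametrization; its values outside `U` are irrelevant -/
  toFun : (Fin (N + 1) → ℝ) → (Fin N → ℂ)
  isOpen_source : IsOpen source
  contDiffOn : ContDiffOn ℝ 2 toFun source
  immersive : ∀ x ∈ source ∩ quadrant (N + 1), Function.Injective (fderiv ℝ toFun x)
  mapsTo : Set.MapsTo toFun (source ∩ quadrant (N + 1)) Ω
  isOpenEmbedding : Topology.IsOpenEmbedding mapsTo.restrict

namespace CornerChart

variable {N : ℕ} {Ω : Set (Fin N → ℂ)}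

/-- The part of `ℝ^(N+1)` that parametrizes a piece of `Ω`. -/
def domain (c : CornerChart Ω) : Set (Fin (N + 1) → ℝ) := c.source ∩ quadrant (N + 1)

/-- The piece of `Ω` that is parametrized. -/
def image (c : CornerChart Ω) : Set (Fin N → ℂ) := c.toFun '' c.domain

/-- Two parametrizations induce the same orientation of the tangent space of `Ω` at each common
point: there their derivatives differ by a linear map of positive determinant. -/
def SameOrientation (c c' : CornerChart Ω) : Prop :=
  ∀ x ∈ c.domain, ∀ y ∈ c'.domain, c.toFun x = c'.toFun y →
    ∃ A : (Fin (N + 1) → ℝ) →L[ℝ] (Fin (N + 1) → ℝ),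
      0 < LinearMap.det (A : (Fin (N + 1) → ℝ) →ₗ[ℝ] (Fin (N + 1) → ℝ)) ∧
      fderiv ℝ c.toFun x = (fderiv ℝ c'.toFun y).comp A

/-- The integral of the pullback of the `N`-form `ω` over the boundary of the chart domain, that
is, over the faces `{x | x k = 0}`, `k = 0, …, N`, each with the boundary orientation (outward
normal first). The outward normal of the `k`-th face is `-e_k`, so that the coordinates
`(x j)_{j ≠ k}`, in increasing order, have the sign `(-1)^(k+1)`. -/
noncomputable def faceIntegral (c : CornerChart Ω)
    (ω : (Fin N → ℂ) → (Fin N → ℂ) [⋀^Fin N]→L[ℝ] ℂ) : ℂ :=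
  ∑ k : Fin (N + 1), (-1 : ℂ) ^ ((k : ℕ) + 1) *
    ∫ y in {y : Fin N → ℝ | k.insertNth (α := fun _ => ℝ) 0 y ∈ c.domain},
      ω (c.toFun (k.insertNth (α := fun _ => ℝ) 0 y)) (fun j : Fin N =>
        fderiv ℝ c.toFun (k.insertNth (α := fun _ => ℝ) 0 y) (Pi.single (k.succAbove j) (1 : ℝ)))

end CornerChart

/-- An oriented atlas of `Ω`. A set with such an atlas is an oriented embedded submanifold with
(possibly empty) boundary and corners of `ℂ^N`, of class `C²` and of real dimension `N + 1`. -/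
structure OrientedAtlas {N : ℕ} (Ω : Set (Fin N → ℂ)) where
  charts : Set (CornerChart Ω)
  covers : ∀ p ∈ Ω, ∃ c ∈ charts, p ∈ c.image
  oriented : ∀ c ∈ charts, ∀ c' ∈ charts, c.SameOrientation c'

/-- A finite family of charts of an oriented atlas of `Ω`, with a smooth partition of unity on `Ω`
subordinate to it. -/
structure OrientedAtlas.Partition {N : ℕ} {Ω : Set (Fin N → ℂ)} (𝒪 : OrientedAtlas Ω) where
  size : ℕ
  chart : Fin size → CornerChart Ω
  chart_mem : ∀ i, chart i ∈ 𝒪.charts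
  weight : SmoothPartitionOfUnity (Fin size) 𝓘(ℝ, Fin N → ℂ) (Fin N → ℂ) Ω
  subordinate : ∀ i, tsupport (weight i) ∩ Ω ⊆ (chart i).image

/-- `∫_{∂Ω} ω`, computed by means of a partition of unity. -/
noncomputable def OrientedAtlas.Partition.boundaryIntegral {N : ℕ} {Ω : Set (Fin N → ℂ)}
    {𝒪 : OrientedAtlas Ω} (P : 𝒪.Partition)
    (ω : (Fin N → ℂ) → (Fin N → ℂ) [⋀^Fin N]→L[ℝ] ℂ) : ℂ :=
  ∑ i, (P.chart i).faceIntegral (fun z => P.weight i z • ω z)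

/-- The integral of the `N`-form `ω` over the oriented boundary `∂Ω` has the value `I`: it can be
computed by a partition of unity, and each partition of unity gives the value `I`. -/
def OrientedAtlas.HasBoundaryIntegral {N : ℕ} {Ω : Set (Fin N → ℂ)} (𝒪 : OrientedAtlas Ω)
    (ω : (Fin N → ℂ) → (Fin N → ℂ) [⋀^Fin N]→L[ℝ] ℂ) (I : ℂ) : Prop :=
  Nonempty 𝒪.Partition ∧ ∀ P : 𝒪.Partition, P.boundaryIntegral ω = I

/-- The form `dz_1 ∧ … ∧ dz_N` on `ℂ^N`; on `(v_1, …, v_N)` its value is the determinant of the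
matrix with rows `v_1, …, v_N`. -/
noncomputable def dzForm (N : ℕ) : (Fin N → ℂ) [⋀^Fin N]→L[ℝ] ℂ :=
  { toMultilinearMap :=
      (Matrix.detRowAlternating (R := ℂ) (n := Fin N)).toMultilinearMap.restrictScalars ℝ
    cont := by
      change Continuous fun v : Matrix (Fin N) (Fin N) ℂ => v.det
      fun_prop
    map_eq_zero_of_eq' := fun v _ _ h hij =>
      (Matrix.detRowAlternating (R := ℂ) (n := Fin N)).map_eq_zero_of_eq v h hij }

/-- `f` is holomorphic on the closed set `Ω`: it is complex differentiable on an open set that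
contains `Ω`. -/
def HolomorphicOnClosed {N : ℕ} (f : (Fin N → ℂ) → ℂ) (Ω : Set (Fin N → ℂ)) : Prop :=
  ∃ V : Set (Fin N → ℂ), IsOpen V ∧ Ω ⊆ V ∧ DifferentiableOn ℂ f V

/-!
The idea is that `f dz_1 ∧ ⋯ ∧ dz_N` is closed: `df` is a complex linear combination of
`dz_1, …, dz_N`, so that `df ∧ dz_1 ∧ ⋯ ∧ dz_N = 0` (`wedge_dzForm_eq_zero`: a complex alternating
`(N+1)`-form on `ℂ^N` is zero, as `N+1` vectors are linearly dependent). The rest is Stokes' theorem for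
submanifolds with corners, proved with the given partition of unity `(ρ_i)`.

In a chart `φ_i`, the divergence theorem on a large box gives Stokes' theorem on the quadrant for
compactly supported forms (`integral_quadrant_extDeriv`). It requires the form to be differentiable
and its exterior derivative to be continuous. As `df ∧ dz = 0`, the exterior derivative of
`φ_i^*(ρ_i f dz)` is `φ_i^*(f dρ_i ∧ dz)`, in which `f` is not differentiated; hence complex
differentiability of `f` suffices, and no smoothness result for holomorphic functions of several
variables is needed. The boundary integral is therefore the sum over `i` of the integrals of
`ω_i = f dρ_i ∧ dz` over the chart domains (`CornerChart.faceIntegral_eq_topIntegral`).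

That sum is `∑ i, ∑ j, ∫ ρ_j ω_i`, with the `(i, j)` term computed in the chart `φ_i`. It may be
computed in the chart `φ_j` instead (`CornerChart.topIntegral_congr_chart`): the transition map is
differentiable relative to the overlap of the chart domains, corners included, with a derivative of
positive determinant, so the change of variables formula applies. For fixed `j` the sum of
`φ_j^* ω_i` over `i` vanishes in the interior of the domain, since `∑ i, ρ_i` is constant on `Ω`
(`CornerChart.sum_pullback_gradForm_eq_zero`).
-/

open MeasureTheory Set Topology

/-! ### Wedge products with a `1`-form -/

/-- The wedge product `L ∧ η` of a complex-valued `1`-form and a complex-valued `n`-form,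
without a normalizing factor: `(L ∧ η)(v_0, …, v_n)` is the sum of
`(-1)^i L(v_i) η(v_0, …, v_n)` with `v_i` omitted in `η`, as in `extDeriv`. -/
noncomputable def wedge {V : Type*} [NormedAddCommGroup V] [NormedSpace ℝ V] {n : ℕ}
    (L : V →L[ℝ] ℂ) (η : V [⋀^Fin n]→L[ℝ] ℂ) : V [⋀^Fin (n + 1)]→L[ℝ] ℂ :=
  ContinuousAlternatingMap.alternatizeUncurryFin (L.smulRight η)

section Wedge

variable {V W : Type*} [NormedAddCommGroup V] [NormedSpace ℝ V]
  [NormedAddCommGroup W] [NormedSpace ℝ W] {n : ℕ}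

lemma wedge_apply (L : V →L[ℝ] ℂ) (η : V [⋀^Fin n]→L[ℝ] ℂ) (v : Fin (n + 1) → V) :
    wedge L η v = ∑ i : Fin (n + 1), (-1 : ℂ) ^ (i : ℕ) * (L (v i) * η (i.removeNth v)) := by
  simp only [wedge, ContinuousAlternatingMap.alternatizeUncurryFin_apply]
  refine Finset.sum_congr rfl fun i _ => ?_
  rw [ContinuousLinearMap.smulRight_apply, ContinuousAlternatingMap.smul_apply, smul_eq_mul,
    zsmul_eq_mul]
  simp

lemma wedge_add_left (L L' : V →L[ℝ] ℂ) (η : V [⋀^Fin n]→L[ℝ] ℂ) :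
    wedge (L + L') η = wedge L η + wedge L' η := by
  ext v
  simp [wedge_apply, add_mul, mul_add, Finset.sum_add_distrib]

lemma wedge_smul_left (a : ℂ) (L : V →L[ℝ] ℂ) (η : V [⋀^Fin n]→L[ℝ] ℂ) :
    wedge (a • L) η = a • wedge L η := by
  ext v
  simp only [wedge_apply, ContinuousAlternatingMap.smul_apply, smul_apply,
    smul_eq_mul, Finset.mul_sum]
  exact Finset.sum_congr rfl fun i _ => by ring

lemma wedge_zero_left (η : V [⋀^Fin n]→L[ℝ] ℂ) : wedge 0 η = 0 := by
  ext v
  simp [wedge_apply]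

lemma wedge_sum_left {ι : Type*} (s : Finset ι) (L : ι → V →L[ℝ] ℂ) (η : V [⋀^Fin n]→L[ℝ] ℂ) :
    wedge (∑ i ∈ s, L i) η = ∑ i ∈ s, wedge (L i) η := by
  classical
  induction s using Finset.induction_on with
  | empty => simp [wedge_zero_left]
  | insert a s ha ih => rw [Finset.sum_insert ha, Finset.sum_insert ha, wedge_add_left, ih]

lemma wedge_compContinuousLinearMap (L : W →L[ℝ] ℂ) (η : W [⋀^Fin n]→L[ℝ] ℂ) (A : V →L[ℝ] W) :
    wedge (L.comp A) (η.compContinuousLinearMap A) =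
      (wedge L η).compContinuousLinearMap A := by
  ext v
  simp only [wedge_apply, ContinuousAlternatingMap.compContinuousLinearMap_apply,
    ContinuousLinearMap.comp_apply]
  rfl

/-- The Leibniz rule for the product of a function and a differential form. -/
lemma extDeriv_fun_smul_form {g : V → ℂ} {η : V → V [⋀^Fin n]→L[ℝ] ℂ} {x : V}
    (hg : DifferentiableAt ℝ g x) (hη : DifferentiableAt ℝ η x) :
    extDeriv (fun y => g y • η y) x = g x • extDeriv η x + wedge (fderiv ℝ g x) (η x) := by
  rw [extDeriv, fderiv_fun_smul hg hη, ContinuousAlternatingMap.alternatizeUncurryFin_add,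
    ContinuousAlternatingMap.alternatizeUncurryFin_smul]
  rfl

end Wedge

/-- There are no nonzero complex `(N+1)`-forms on `ℂ^N`; this is where holomorphy enters. -/
lemma wedge_dzForm_eq_zero {N : ℕ} (L : (Fin N → ℂ) →L[ℂ] ℂ) :
    wedge (L.restrictScalars ℝ) (dzForm N) = 0 := by
  ext v
  let A : (Fin N → ℂ) [⋀^Fin (N + 1)]→ₗ[ℂ] ℂ := AlternatingMap.alternatizeUncurryFin
    ((L : (Fin N → ℂ) →ₗ[ℂ] ℂ).smulRight (Matrix.detRowAlternating (R := ℂ) (n := Fin N)))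
  have hdep : ¬ LinearIndependent ℂ v := fun h => by
    simpa using h.fintype_card_le_finrank
  have h := A.map_linearDependent v hdep
  rw [AlternatingMap.alternatizeUncurryFin_apply] at h
  rw [wedge_apply]
  refine Eq.trans ?_ h
  refine Finset.sum_congr rfl fun i _ => ?_
  rw [LinearMap.smulRight_apply, AlternatingMap.smul_apply, smul_eq_mul, zsmul_eq_mul]
  push_cast
  rfl

/-! ### Stokes' theorem on the quadrant -/

/-- The exterior derivative of the zero germ vanishes. -/
lemma extDeriv_eq_zero_of_notMem_tsupport {V : Type*} [NormedAddCommGroup V] [NormedSpace ℝ V]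
    {n : ℕ} {α : V → V [⋀^Fin n]→L[ℝ] ℂ} {x : V} (hx : x ∉ tsupport α) : extDeriv α x = 0 := by
  have h : fderiv ℝ α x = 0 := by
    rw [(notMem_tsupport_iff_eventuallyEq.mp hx).fderiv_eq]
    simp
  rw [extDeriv, h]
  ext v
  simp [ContinuousAlternatingMap.alternatizeUncurryFin_apply]

lemma measurableSet_quadrant (n : ℕ) : MeasurableSet (quadrant n) := by
  have : quadrant n = Set.Ici 0 := by ext x; simp [quadrant, Pi.le_def]
  rw [this]; exact measurableSet_Ici

/-- Stokes' theorem on the quadrant `[0, ∞)^(n+1)`. -/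
theorem integral_quadrant_extDeriv {n : ℕ}
    {α : (Fin (n + 1) → ℝ) → (Fin (n + 1) → ℝ) [⋀^Fin n]→L[ℝ] ℂ}
    (hα : Differentiable ℝ α) (hc : HasCompactSupport α)
    (hd : Continuous fun x => extDeriv α x fun i => Pi.single i (1 : ℝ)) :
    ∫ x in quadrant (n + 1), extDeriv α x (fun i => Pi.single i (1 : ℝ)) =
      ∑ k : Fin (n + 1), (-1 : ℂ) ^ ((k : ℕ) + 1) *
        ∫ y in quadrant n, α (k.insertNth (α := fun _ => ℝ) 0 y)
          (fun j => Pi.single (k.succAbove j) (1 : ℝ)) := by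
  obtain ⟨r, hr0, hr⟩ := hc.isCompact.isBounded.subset_closedBall_lt 0 0
  have hout : ∀ x : Fin (n + 1) → ℝ, ∀ k, r < x k → x ∉ tsupport α := by
    intro x k hk hx
    have h1 := hr hx
    rw [mem_closedBall_zero_iff] at h1
    have h2 := norm_le_pi_norm x k
    rw [Real.norm_eq_abs] at h2
    linarith [le_abs_self (x k)]
  have hzero : ∀ x : Fin (n + 1) → ℝ, ∀ k, r < x k → α x = 0 := fun x k hk =>
    image_eq_zero_of_notMem_tsupport (hout x k hk)
  have hd0 : ∀ x : Fin (n + 1) → ℝ, ∀ k, r < x k → extDeriv α x = 0 := fun x k hk =>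
    extDeriv_eq_zero_of_notMem_tsupport (hout x k hk)
  let e : Fin (n + 1) → Fin (n + 1) → ℝ := fun i => Pi.single i 1
  -- `α` vanishes on the faces `x k = r + 1` of the box `[0, b]`.
  let b : Fin (n + 1) → ℝ := fun _ => r + 1
  let F : Fin (n + 1) → (Fin (n + 1) → ℝ) → ℂ := fun k x => (-1 : ℂ) ^ (k : ℕ) * α x (k.removeNth e)
  let F' : Fin (n + 1) → (Fin (n + 1) → ℝ) → (Fin (n + 1) → ℝ) →L[ℝ] ℂ :=
    fun k x => (-1 : ℂ) ^ (k : ℕ) • fderiv ℝ (fun x => α x (k.removeNth e)) x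
  have hFd : ∀ k x, HasFDerivAt (F k) (F' k x) x := by
    intro k x
    have : DifferentiableAt ℝ (fun x => α x (k.removeNth e)) x := by
      exact (ContinuousAlternatingMap.apply ℝ (Fin (n + 1) → ℝ) ℂ
        (k.removeNth e)).differentiableAt.comp x (hα x)
    exact this.hasFDerivAt.const_smul ((-1 : ℂ) ^ (k : ℕ))
  have hdiv : ∀ x, ∑ k, F' k x (e k) = extDeriv α x e := by
    intro x
    rw [extDeriv_apply (hα x)]
    refine Finset.sum_congr rfl fun k _ => ?_
    simp only [F', smul_apply, zsmul_eq_mul, smul_eq_mul]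
    push_cast
    rfl
  have hb : (0 : Fin (n + 1) → ℝ) ≤ b := fun i => by simp only [b, Pi.zero_apply]; linarith
  have key := integral_divergence_of_hasFDerivAt_off_countable' 0 b hb F F' ∅
    countable_empty (fun k x _ => (hFd k x).continuousAt.continuousWithinAt)
    (fun x _ k => hFd k x)
    (by
      change IntegrableOn (fun x => ∑ k, F' k x (e k)) _ _
      simp only [hdiv]
      exact hd.continuousOn.integrableOn_compact isCompact_Icc)
  have hL : ∫ x in quadrant (n + 1), extDeriv α x e = ∫ x in Icc 0 b, ∑ k, F' k x (e k) := by
    simp only [hdiv]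
    refine (setIntegral_eq_of_subset_of_forall_sdiff_eq_zero (measurableSet_quadrant _) ?_ ?_)
    · intro x hx i; exact hx.1 i
    · rintro x ⟨hx, hxb⟩
      have : ∃ k, r < x k := by
        by_contra! hcon
        exact hxb ⟨fun i => hx i, fun i => (hcon i).trans (by simp [b])⟩
      obtain ⟨k, hk⟩ := this
      rw [hd0 x k hk]; rfl
  change ∫ x in quadrant (n + 1), extDeriv α x e = _
  rw [hL, key]
  refine Finset.sum_congr rfl fun k _ => ?_
  have h1 : ∀ y : Fin n → ℝ, F k (k.insertNth (α := fun _ => ℝ) (b k) y) = 0 := by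
    intro y
    simp only [F]
    rw [hzero _ k (by simp [b])]
    simp
  simp only [h1, integral_zero, zero_sub]
  have h2 : ∫ y in Icc ((0 : Fin (n + 1) → ℝ) ∘ k.succAbove) (b ∘ k.succAbove),
      F k (k.insertNth (α := fun _ => ℝ) 0 y) =
      ∫ y in quadrant n, F k (k.insertNth (α := fun _ => ℝ) 0 y) := by
    refine (setIntegral_eq_of_subset_of_forall_sdiff_eq_zero
      (measurableSet_quadrant _) ?_ ?_).symm
    · intro x hx i; exact hx.1 i
    · rintro y ⟨hy, hyb⟩
      have : ∃ j, r < y j := by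
        by_contra! hcon
        exact hyb ⟨fun i => hy i, fun i => (hcon i).trans (by simp [b])⟩
      obtain ⟨j, hj⟩ := this
      simp only [F]
      rw [hzero _ (k.succAbove j) (by simpa using hj)]
      simp
  change -∫ y in Icc ((0 : Fin (n + 1) → ℝ) ∘ k.succAbove) (b ∘ k.succAbove),
      F k (k.insertNth (α := fun _ => ℝ) 0 y) = _
  rw [h2]
  simp only [F]
  rw [integral_const_mul, pow_succ]
  simp only [mul_neg, mul_one, neg_mul]
  rfl

/-! ### Charts and change of variables -/

/-- The pullback along an endomorphism multiplies a top-degree form by the determinant. -/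
lemma ContinuousAlternatingMap.apply_comp_eq_det_mul {m : ℕ}
    (η : (Fin m → ℝ) [⋀^Fin m]→L[ℝ] ℂ) (A : (Fin m → ℝ) →L[ℝ] (Fin m → ℝ)) :
    η (fun i => A (Pi.single i 1)) =
      LinearMap.det (A : (Fin m → ℝ) →ₗ[ℝ] (Fin m → ℝ)) • η (fun i => Pi.single i 1) := by
  let e := Pi.basisFun ℝ (Fin m)
  have he : ∀ i, Pi.single i (1 : ℝ) = e i := fun i => by simp [e]
  -- Two alternating maps that agree on the permutations of a basis are equal.
  have hη : η.toAlternatingMap =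
      (LinearMap.toSpanSingleton ℝ ℂ (η e)).compAlternatingMap e.det := by
    refine Module.Basis.ext_alternating e fun v hv => ?_
    obtain ⟨σ, rfl⟩ : ∃ σ : Equiv.Perm (Fin m), v = σ :=
      ⟨Equiv.ofBijective v (Finite.injective_iff_bijective.1 hv), rfl⟩
    have h1 := η.toAlternatingMap.map_perm e σ
    have h2 := e.det.map_perm e σ
    rw [LinearMap.compAlternatingMap_apply, LinearMap.toSpanSingleton_apply]
    simp only [Function.comp_def] at h1 h2
    rw [h1, h2, e.det_self]
    simp [Units.smul_def]
  have h := congrArg (fun g => g ((A : (Fin m → ℝ) →ₗ[ℝ] (Fin m → ℝ)) ∘ e)) hη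
  simp only [LinearMap.compAlternatingMap_apply, e.det_comp, e.det_self, mul_one,
    LinearMap.toSpanSingleton_apply] at h
  simp only [he]
  exact h

namespace CornerChart

variable {N : ℕ} {Ω : Set (Fin N → ℂ)}

lemma measurableSet_domain (c : CornerChart Ω) : MeasurableSet c.domain :=
  c.isOpen_source.measurableSet.inter (measurableSet_quadrant _)

lemma contDiffAt (c : CornerChart Ω) {x : Fin (N + 1) → ℝ} (hx : x ∈ c.source) :
    ContDiffAt ℝ 2 c.toFun x :=
  c.contDiffOn.contDiffAt (c.isOpen_source.mem_nhds hx)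

lemma differentiableAt (c : CornerChart Ω) {x : Fin (N + 1) → ℝ} (hx : x ∈ c.source) :
    DifferentiableAt ℝ c.toFun x :=
  (c.contDiffAt hx).differentiableAt (by norm_num)

lemma injOn (c : CornerChart Ω) : InjOn c.toFun c.domain :=
  c.mapsTo.restrict_inj.1 c.isOpenEmbedding.injective

lemma exists_isOpen_image (c : CornerChart Ω) : ∃ O, IsOpen O ∧ c.image = Ω ∩ O := by
  obtain ⟨O, hO, h⟩ := isOpen_induced_iff.1 c.isOpenEmbedding.isOpen_range
  refine ⟨O, hO, ?_⟩
  ext p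
  constructor
  · rintro ⟨x, hx, rfl⟩
    refine ⟨c.mapsTo hx, ?_⟩
    have hmem : (⟨c.toFun x, c.mapsTo hx⟩ : Ω) ∈ range c.mapsTo.restrict := ⟨⟨x, hx⟩, rfl⟩
    rw [← h] at hmem
    exact hmem
  · rintro ⟨hp, hpO⟩
    have : (⟨p, hp⟩ : Ω) ∈ range c.mapsTo.restrict := h ▸ hpO
    obtain ⟨⟨x, hx⟩, hxp⟩ := this
    exact ⟨x, hx, congrArg Subtype.val hxp⟩

/-- Convergence in the domain of a chart can be tested in `Ω`. -/
lemma tendsto_of_tendsto_toFun (c : CornerChart Ω) {X : Type*} {l : Filter X}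
    {g : X → Fin (N + 1) → ℝ} {y : Fin (N + 1) → ℝ} (hg : ∀ᶠ x in l, g x ∈ c.domain)
    (hy : y ∈ c.domain) (h : Filter.Tendsto (fun x => c.toFun (g x)) l (𝓝 (c.toFun y))) :
    Filter.Tendsto g l (𝓝 y) := by
  classical
  let G : X → ↥(c.source ∩ quadrant (N + 1)) :=
    fun x => if hx : g x ∈ c.domain then ⟨g x, hx⟩ else ⟨y, hy⟩
  have hG : Filter.Tendsto G l (𝓝 ⟨y, hy⟩) := by
    rw [c.isOpenEmbedding.toIsInducing.tendsto_nhds_iff, tendsto_subtype_rng]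
    refine h.congr' ?_
    filter_upwards [hg] with x hx
    simp [G, hx]
  refine ((continuous_subtype_val.tendsto _).comp hG).congr' ?_
  filter_upwards [hg] with x hx
  simp [G, hx]

/-- A map between the domains of two charts that is compatible with the parametrizations is
differentiable. With `L` a left inverse of the derivative of the second parametrization `φ'`, it is
locally the composition of `L ∘ φ` with a local inverse of `L ∘ φ'`. -/
lemma hasFDerivWithinAt_transition (c c' : CornerChart Ω) {s : Set (Fin (N + 1) → ℝ)}
    {τ : (Fin (N + 1) → ℝ) → Fin (N + 1) → ℝ} (hs : s ⊆ c.domain)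
    (hτ : MapsTo τ s c'.domain) (hcomp : ∀ x ∈ s, c'.toFun (τ x) = c.toFun x)
    {x : Fin (N + 1) → ℝ} (hx : x ∈ s) {A : (Fin (N + 1) → ℝ) →L[ℝ] (Fin (N + 1) → ℝ)}
    (hA : fderiv ℝ c.toFun x = (fderiv ℝ c'.toFun (τ x)).comp A) :
    HasFDerivWithinAt τ A s x := by
  have hcd := (c.differentiableAt (hs hx).1).hasFDerivAt
  have hlim : Filter.Tendsto τ (𝓝[s] x) (𝓝 (τ x)) := by
    refine c'.tendsto_of_tendsto_toFun (eventually_mem_nhdsWithin.mono hτ) (hτ hx) ?_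
    rw [hcomp x hx]
    refine (hcd.continuousAt.continuousWithinAt (s := s)).tendsto.congr' ?_
    filter_upwards [self_mem_nhdsWithin] with z hz using (hcomp z hz).symm
  obtain ⟨L₀, hL₀⟩ := LinearMap.exists_leftInverse_of_injective
    (fderiv ℝ c'.toFun (τ x) : (Fin (N + 1) → ℝ) →ₗ[ℝ] (Fin N → ℂ))
    (LinearMap.ker_eq_bot.2 (c'.immersive _ (hτ hx)))
  let L : (Fin N → ℂ) →L[ℝ] (Fin (N + 1) → ℝ) := L₀.toContinuousLinearMap
  have hL : L.comp (fderiv ℝ c'.toFun (τ x)) = ContinuousLinearMap.id ℝ _ := by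
    ext1 v
    exact congrArg (fun g => g v) hL₀
  have hstrict : HasStrictFDerivAt (fun y => L (c'.toFun y))
      (ContinuousLinearEquiv.refl ℝ (Fin (N + 1) → ℝ) :
        (Fin (N + 1) → ℝ) →L[ℝ] (Fin (N + 1) → ℝ)) (τ x) := by
    have := L.hasStrictFDerivAt.comp (τ x)
      ((c'.contDiffAt (hτ hx).1).hasStrictFDerivAt (by norm_num))
    rw [hL] at this
    exact this
  have hinv := hstrict.to_localInverse.hasFDerivAt
  have hLc : HasFDerivWithinAt (fun z => L (c.toFun z)) A s x := by
    have := (L.hasFDerivAt.comp x hcd).hasFDerivWithinAt (s := s)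
    rw [hA, ← ContinuousLinearMap.comp_assoc, hL, ContinuousLinearMap.id_comp] at this
    exact this
  rw [hcomp x hx] at hinv
  have hfin := hinv.comp_hasFDerivWithinAt x hLc
  refine HasFDerivWithinAt.congr_of_eventuallyEq
    (f := hstrict.localInverse _ _ _ ∘ fun z => L (c.toFun z)) ?_ ?_ ?_
  · simpa using hfin
  · filter_upwards [hlim.eventually hstrict.eventually_left_inverse, self_mem_nhdsWithin]
      with z hz hzs
    rw [← hz]
    simp [hcomp z hzs]
  · have := hstrict.eventually_left_inverse.self_of_nhds
    refine this.symm.trans ?_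
    simp [hcomp x hx]

/-- The integral over a chart domain of the pullback of the `(N+1)`-form `ω`. -/
noncomputable def topIntegral (c : CornerChart Ω)
    (ω : (Fin N → ℂ) → (Fin N → ℂ) [⋀^Fin (N + 1)]→L[ℝ] ℂ) : ℂ :=
  ∫ x in c.domain, (ω (c.toFun x)).compContinuousLinearMap (fderiv ℝ c.toFun x)
    (fun i => Pi.single i (1 : ℝ))

/-- The integral of a top-degree form supported in two charts does not depend on the chart. -/
theorem topIntegral_congr_chart (c c' : CornerChart Ω) (hcc : c.SameOrientation c')
    {ω : (Fin N → ℂ) → (Fin N → ℂ) [⋀^Fin (N + 1)]→L[ℝ] ℂ}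
    (hω : ∀ p ∈ Ω, ω p ≠ 0 → p ∈ c.image ∧ p ∈ c'.image) :
    c.topIntegral ω = c'.topIntegral ω := by
  classical
  obtain ⟨O, hO, hcO⟩ := c'.exists_isOpen_image
  let s := c.domain ∩ c.toFun ⁻¹' c'.image
  let s' := c'.domain ∩ c'.toFun ⁻¹' c.image
  have hs : MeasurableSet s := by
    have : s = (c.source ∩ c.toFun ⁻¹' O) ∩ quadrant (N + 1) := by
      ext x
      simp only [s, hcO, domain, mem_inter_iff, mem_preimage]
      constructor
      · tauto
      · rintro ⟨⟨h1, h2⟩, h3⟩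
        exact ⟨⟨h1, h3⟩, c.mapsTo ⟨h1, h3⟩, h2⟩
    rw [this]
    exact (c.contDiffOn.continuousOn.isOpen_inter_preimage c.isOpen_source hO).measurableSet.inter
      (measurableSet_quadrant _)
  have hex : ∀ x ∈ s, ∃ y ∈ c'.domain, c'.toFun y = c.toFun x := fun x hx => hx.2
  choose! τ hτ hcomp using hex
  choose! A hdet hA using fun x (hx : x ∈ s) =>
    hcc x hx.1 (τ x) (hτ x hx) (hcomp x hx).symm
  have himage : τ '' s = s' := by
    ext y
    constructor
    · rintro ⟨x, hx, rfl⟩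
      exact ⟨hτ x hx, x, hx.1, (hcomp x hx).symm⟩
    · rintro ⟨hy, x, hx, hxy⟩
      have hxs : x ∈ s := ⟨hx, y, hy, hxy.symm⟩
      exact ⟨x, hxs, c'.injOn (hτ x hxs) hy ((hcomp x hxs).trans hxy)⟩
  have hinj : InjOn τ s := fun x hx z hz hxz =>
    c.injOn hx.1 hz.1 (by rw [← hcomp x hx, ← hcomp z hz, hxz])
  have h1 : c.topIntegral ω = ∫ x in s, (ω (c.toFun x)).compContinuousLinearMap
      (fderiv ℝ c.toFun x) (fun i => Pi.single i (1 : ℝ)) := by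
    refine setIntegral_eq_of_subset_of_forall_sdiff_eq_zero c.measurableSet_domain
      inter_subset_left fun x hx => ?_
    have : ω (c.toFun x) = 0 := by
      by_contra hne
      exact hx.2 ⟨hx.1, (hω _ (c.mapsTo hx.1) hne).2⟩
    rw [this]; rfl
  have h2 : c'.topIntegral ω = ∫ x in s', (ω (c'.toFun x)).compContinuousLinearMap
      (fderiv ℝ c'.toFun x) (fun i => Pi.single i (1 : ℝ)) := by
    refine setIntegral_eq_of_subset_of_forall_sdiff_eq_zero c'.measurableSet_domain
      inter_subset_left fun x hx => ?_
    have : ω (c'.toFun x) = 0 := by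
      by_contra hne
      exact hx.2 ⟨hx.1, (hω _ (c'.mapsTo hx.1) hne).1⟩
    rw [this]; rfl
  rw [h1, h2, ← himage, integral_image_eq_integral_abs_det_fderiv_smul volume hs
    (fun x hx => hasFDerivWithinAt_transition c c' inter_subset_left hτ hcomp hx (hA x hx)) hinj]
  refine setIntegral_congr_fun hs fun x hx => ?_
  have hdetx : 0 < (A x).det := hdet x hx
  rw [abs_of_pos hdetx, hA x hx, hcomp x hx]
  exact ContinuousAlternatingMap.apply_comp_eq_det_mul
    ((ω (c.toFun x)).compContinuousLinearMap (fderiv ℝ c'.toFun (τ x))) (A x)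

end CornerChart

/-! ### Pullbacks of `f dz_1 ∧ ⋯ ∧ dz_N` -/

lemma differentiableAt_compContinuousLinearMap_fderiv {V W : Type*} [NormedAddCommGroup V]
    [NormedSpace ℝ V] [NormedAddCommGroup W] [NormedSpace ℝ W] {n : ℕ} (η : W [⋀^Fin n]→L[ℝ] ℂ)
    {φ : V → W} {x : V} (hφ : ContDiffAt ℝ 2 φ x) :
    DifferentiableAt ℝ (fun y => η.compContinuousLinearMap (fderiv ℝ φ y)) x :=
  (differentiableAt_const η).continuousAlternatingMapCompContinuousLinearMap
    ((hφ.fderiv_right (m := 1) (by norm_num)).differentiableAt (by norm_num))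

/-- The pullback of a constant form is closed. -/
lemma extDeriv_compContinuousLinearMap_fderiv {V W : Type*} [NormedAddCommGroup V]
    [NormedSpace ℝ V] [NormedAddCommGroup W] [NormedSpace ℝ W] {n : ℕ} (η : W [⋀^Fin n]→L[ℝ] ℂ)
    {φ : V → W} {x : V} (hφ : ContDiffAt ℝ 2 φ x) :
    extDeriv (fun y => η.compContinuousLinearMap (fderiv ℝ φ y)) x = 0 := by
  rw [extDeriv_pullback (ω := fun _ => η) (differentiableAt_const η) hφ (by simp)]
  have : extDeriv (fun _ : W => η) (φ x) = 0 := by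
    ext v
    simp [extDeriv, ContinuousAlternatingMap.alternatizeUncurryFin_apply]
  rw [this]
  rfl

/-- If `f` is holomorphic, the exterior derivative of the pullback of `f dz_1 ∧ ⋯ ∧ dz_N`, cut off
by a function `u`, involves the derivative of `u` only. -/
lemma extDeriv_cutoff_pullback {N : ℕ} {V : Type*} [NormedAddCommGroup V] [NormedSpace ℝ V]
    {φ : V → Fin N → ℂ} {f : (Fin N → ℂ) → ℂ} {u : V → ℝ} {x : V} (hφ : ContDiffAt ℝ 2 φ x)
    (hf : DifferentiableAt ℂ f (φ x)) (hu : DifferentiableAt ℝ u x) :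
    extDeriv (fun y => ((u y : ℂ) * f (φ y)) •
        (dzForm N).compContinuousLinearMap (fderiv ℝ φ y)) x =
      f (φ x) • wedge (Complex.ofRealCLM.comp (fderiv ℝ u x))
        ((dzForm N).compContinuousLinearMap (fderiv ℝ φ x)) := by
  have hφd := hφ.differentiableAt (by norm_num)
  have hfφ : HasFDerivAt (fun y => f (φ y))
      (((fderiv ℂ f (φ x)).restrictScalars ℝ).comp (fderiv ℝ φ x)) x :=
    (hf.hasFDerivAt.restrictScalars ℝ).comp x hφd.hasFDerivAt
  have huC : HasFDerivAt (fun y => (u y : ℂ)) (Complex.ofRealCLM.comp (fderiv ℝ u x)) x :=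
    Complex.ofRealCLM.hasFDerivAt.comp x hu.hasFDerivAt
  have hg := huC.fun_mul hfφ
  rw [extDeriv_fun_smul_form hg.differentiableAt
    (differentiableAt_compContinuousLinearMap_fderiv _ hφ), hg.fderiv,
    extDeriv_compContinuousLinearMap_fderiv _ hφ, smul_zero, zero_add, wedge_add_left,
    wedge_smul_left, wedge_smul_left, wedge_compContinuousLinearMap, wedge_dzForm_eq_zero]
  ext v
  simp

lemma ContinuousOn.wedge_compContinuousLinearMap_apply {X V W : Type*} [TopologicalSpace X]
    [NormedAddCommGroup V] [NormedSpace ℝ V] [NormedAddCommGroup W] [NormedSpace ℝ W] {n : ℕ}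
    {s : Set X} {L : X → V →L[ℝ] ℂ} {D : X → V →L[ℝ] W} (hL : ContinuousOn L s)
    (hD : ContinuousOn D s) (η : W [⋀^Fin n]→L[ℝ] ℂ) (v : Fin (n + 1) → V) :
    ContinuousOn (fun x => wedge (L x) (η.compContinuousLinearMap (D x)) v) s := by
  simp only [wedge_apply]
  refine continuousOn_finsetSum _ fun i _ => continuousOn_const.mul (ContinuousOn.mul ?_ ?_)
  · fun_prop
  · exact η.cont.comp_continuousOn
      (continuousOn_pi.2 fun j => hD.clm_apply continuousOn_const)

/-- Stokes' theorem for the pullback of `u f dz_1 ∧ ⋯ ∧ dz_N` to the quadrant, for a cutoff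
function `u`. -/
theorem sum_integral_faces_eq_integral_quadrant {N : ℕ} {φ : (Fin (N + 1) → ℝ) → Fin N → ℂ}
    {U : Set (Fin (N + 1) → ℝ)} (hU : IsOpen U) (hφ : ContDiffOn ℝ 2 φ U)
    {f : (Fin N → ℂ) → ℂ} (hf : ∀ x ∈ U, DifferentiableAt ℂ f (φ x))
    {u : (Fin (N + 1) → ℝ) → ℝ} (hu : ContDiff ℝ 1 u) (hc : HasCompactSupport u)
    (hsupp : tsupport u ⊆ U) :
    ∑ k : Fin (N + 1), (-1 : ℂ) ^ ((k : ℕ) + 1) *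
        ∫ y in quadrant N, (fun x => ((u x : ℂ) * f (φ x)) •
            (dzForm N).compContinuousLinearMap (fderiv ℝ φ x))
          (k.insertNth (α := fun _ => ℝ) 0 y) (fun j => Pi.single (k.succAbove j) (1 : ℝ)) =
      ∫ x in quadrant (N + 1), f (φ x) * wedge (Complex.ofRealCLM.comp (fderiv ℝ u x))
        ((dzForm N).compContinuousLinearMap (fderiv ℝ φ x)) (fun i => Pi.single i (1 : ℝ)) := by
  set α : (Fin (N + 1) → ℝ) → (Fin (N + 1) → ℝ) [⋀^Fin N]→L[ℝ] ℂ := fun x =>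
    ((u x : ℂ) * f (φ x)) • (dzForm N).compContinuousLinearMap (fderiv ℝ φ x) with hα
  have hat : ∀ x ∈ U, ContDiffAt ℝ 2 φ x := fun x hx => hφ.contDiffAt (hU.mem_nhds hx)
  have hud : Differentiable ℝ u := hu.differentiable (by norm_num)
  have hαu : tsupport α ⊆ tsupport u := by
    refine closure_mono fun x hx hux => hx ?_
    ext v
    simp [hα, hux]
  have hdU : ∀ x ∈ U, extDeriv α x = f (φ x) • wedge (Complex.ofRealCLM.comp (fderiv ℝ u x))
      ((dzForm N).compContinuousLinearMap (fderiv ℝ φ x)) := fun x hx =>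
    extDeriv_cutoff_pullback (hat x hx) (hf x hx) (hud x)
  have hd : ∀ x, extDeriv α x = f (φ x) • wedge (Complex.ofRealCLM.comp (fderiv ℝ u x))
      ((dzForm N).compContinuousLinearMap (fderiv ℝ φ x)) := by
    intro x
    by_cases hx : x ∈ tsupport u
    · exact hdU x (hsupp hx)
    · rw [extDeriv_eq_zero_of_notMem_tsupport fun h => hx (hαu h),
        fderiv_of_notMem_tsupport ℝ hx, ContinuousLinearMap.comp_zero, wedge_zero_left]
      ext v
      simp
  have hdiff : Differentiable ℝ α := by
    intro x
    by_cases hx : x ∈ tsupport u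
    · have hxU := hsupp hx
      have h1 : DifferentiableAt ℝ (fun y => f (φ y)) x :=
        ((hf x hxU).restrictScalars ℝ).comp x ((hat x hxU).differentiableAt (by norm_num))
      have h2 : DifferentiableAt ℝ (fun y => (u y : ℂ)) x :=
        Complex.ofRealCLM.differentiableAt.comp x (hud x)
      exact (h2.mul h1).smul (differentiableAt_compContinuousLinearMap_fderiv _ (hat x hxU))
    · exact ((notMem_tsupport_iff_eventuallyEq.mp fun h => hx (hαu h)).differentiableAt_iff).2
        (differentiableAt_const 0)
  have hcont : Continuous fun x => extDeriv α x fun i => Pi.single i (1 : ℝ) := by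
    refine continuous_of_tsupport fun x hx => ?_
    have hxU : x ∈ U := by
      refine hsupp (closure_minimal (fun z hz => ?_) (isClosed_tsupport u) hx)
      by_contra hzu
      exact hz (by
        change extDeriv α z _ = 0
        rw [extDeriv_eq_zero_of_notMem_tsupport fun h => hzu (hαu h)]; rfl)
    simp only [hd, ContinuousAlternatingMap.smul_apply]
    have h1 : ContinuousOn (fun y => f (φ y)) U := fun y hy =>
      ((hf y hy).continuousAt.comp (hat y hy).continuousAt).continuousWithinAt
    have h2 : ContinuousOn (fderiv ℝ φ) U := fun y hy =>
      ((hat y hy).fderiv_right (m := 1) (by norm_num)).continuousAt.continuousWithinAt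
    have h3 : Continuous fun y => Complex.ofRealCLM.comp (fderiv ℝ u y) :=
      continuous_const.clm_comp (hu.continuous_fderiv (by norm_num))
    exact (h1.smul (h3.continuousOn.wedge_compContinuousLinearMap_apply h2 _ _)).continuousAt
      (hU.mem_nhds hxU)
  rw [← integral_quadrant_extDeriv hdiff (hc.of_isClosed_subset (isClosed_tsupport _) hαu) hcont]
  simp only [hd]
  rfl

/-! ### Stokes' theorem in a chart -/

lemma ae_pos_of_mem_quadrant (m : ℕ) : ∀ᵐ x : Fin m → ℝ, x ∈ quadrant m → ∀ i, 0 < x i := by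
  have h := Measure.univ_pi_Ioi_ae_eq_Ici (μ := fun _ : Fin m => (volume : Measure ℝ))
    (f := fun _ => (0 : ℝ))
  filter_upwards [h.mem_iff] with x hx hxq i
  exact hx.2 (fun i => hxq i) i (mem_univ i)

lemma quadrant_mem_nhds {m : ℕ} {x : Fin m → ℝ} (hx : ∀ i, 0 < x i) : quadrant m ∈ 𝓝 x := by
  have : Set.pi univ (fun _ : Fin m => Ioi (0 : ℝ)) ∈ 𝓝 x :=
    (isOpen_set_pi finite_univ fun _ _ => isOpen_Ioi).mem_nhds fun i _ => hx i
  exact Filter.mem_of_superset this fun y hy i => (hy i (mem_univ i)).le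

/-- The `(N+1)`-form `f dρ ∧ dz_1 ∧ ⋯ ∧ dz_N`. -/
noncomputable def gradForm {N : ℕ} (f : (Fin N → ℂ) → ℂ) (ρ : (Fin N → ℂ) → ℝ) :
    (Fin N → ℂ) → (Fin N → ℂ) [⋀^Fin (N + 1)]→L[ℝ] ℂ :=
  fun p => f p • wedge (Complex.ofRealCLM.comp (fderiv ℝ ρ p)) (dzForm N)

lemma gradForm_eq_zero {N : ℕ} {f : (Fin N → ℂ) → ℂ} {ρ : (Fin N → ℂ) → ℝ} {p : Fin N → ℂ}
    (hp : p ∉ tsupport ρ) : gradForm f ρ p = 0 := by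
  rw [gradForm, fderiv_of_notMem_tsupport ℝ hp, ContinuousLinearMap.comp_zero, wedge_zero_left]
  ext v
  simp

namespace CornerChart

variable {N : ℕ} {Ω : Set (Fin N → ℂ)}

/-- A closed set whose trace on `Ω` lies in the image of a chart has a compact preimage in the
domain of the chart. -/
lemma isCompact_domain_inter_preimage (c : CornerChart Ω) (hΩ : IsCompact Ω)
    {T : Set (Fin N → ℂ)} (hT : IsClosed T) (hTc : T ∩ Ω ⊆ c.image) :
    IsCompact (c.domain ∩ c.toFun ⁻¹' T) := by
  have hcpt : IsCompact (Subtype.val ⁻¹' T : Set Ω) := by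
    have := isCompact_iff_compactSpace.1 hΩ
    exact (hT.preimage continuous_subtype_val).isCompact
  have hpre := c.isOpenEmbedding.toIsInducing.isCompact_preimage' hcpt (by
    rintro ⟨p, hp⟩ hpT
    obtain ⟨x, hx, hxp⟩ := hTc ⟨hpT, hp⟩
    exact ⟨⟨x, hx⟩, Subtype.ext hxp⟩)
  have := hpre.image continuous_subtype_val
  convert this using 1
  ext x
  constructor
  · rintro ⟨hx, hxT⟩
    exact ⟨⟨x, hx⟩, hxT, rfl⟩
  · rintro ⟨⟨z, hz⟩, hzT, rfl⟩
    exact ⟨hz, hzT⟩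

/-- Stokes' theorem in one chart, for the form `ρ f dz_1 ∧ ⋯ ∧ dz_N` with `f` holomorphic and `ρ`
supported in the chart. -/
theorem faceIntegral_eq_topIntegral (c : CornerChart Ω) (hΩ : IsCompact Ω)
    {V : Set (Fin N → ℂ)} (hV : IsOpen V) (hΩV : Ω ⊆ V) {f : (Fin N → ℂ) → ℂ}
    (hf : DifferentiableOn ℂ f V) {ρ : (Fin N → ℂ) → ℝ} (hρ : ContDiff ℝ 1 ρ)
    (hρc : tsupport ρ ∩ Ω ⊆ c.image) :
    c.faceIntegral (fun z => ρ z • f z • dzForm N) = c.topIntegral (gradForm f ρ) := by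
  set K := c.domain ∩ c.toFun ⁻¹' (tsupport ρ) with hKdef
  have hK : IsCompact K := c.isCompact_domain_inter_preimage hΩ (isClosed_tsupport ρ) hρc
  -- The part of the source on which `f ∘ φ` is known to be differentiable.
  set U := c.source ∩ c.toFun ⁻¹' V with hUdef
  have hU : IsOpen U := c.contDiffOn.continuousOn.isOpen_inter_preimage c.isOpen_source hV
  have hDU : c.domain ⊆ U := fun x hx => ⟨hx.1, hΩV (c.mapsTo hx)⟩
  obtain ⟨M, hM, hKM, hMU⟩ := exists_compact_between hK hU (inter_subset_left.trans hDU)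
  obtain ⟨χ, hχ1, hχ0, -⟩ := exists_contMDiffMap_one_nhds_of_subset_interior
    (n := 1) 𝓘(ℝ, Fin (N + 1) → ℝ) hK.isClosed hKM
  have hχ : ContDiff ℝ 1 χ := χ.contMDiff.contDiff
  have hχsupp : tsupport χ ⊆ M := closure_minimal
    (fun x hx => by_contra fun hxM => hx (hχ0 x hxM)) hM.isClosed
  -- A globally `C¹` function that agrees with `ρ ∘ φ` on the domain of the chart.
  let u : (Fin (N + 1) → ℝ) → ℝ := fun x => χ x * ρ (c.toFun x)
  have husupp : tsupport u ⊆ tsupport χ := closure_mono fun x hx hχx => hx (by simp [u, hχx])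
  have hu : ContDiff ℝ 1 u := by
    rw [contDiff_iff_contDiffAt]
    intro x
    by_cases hx : x ∈ tsupport χ
    · exact hχ.contDiffAt.mul (hρ.contDiffAt.comp x
        ((c.contDiffAt (hMU (hχsupp hx)).1).of_le (by norm_num)))
    · exact contDiffAt_const.congr_of_eventuallyEq
        (notMem_tsupport_iff_eventuallyEq.mp fun h => hx (husupp h))
  have huc : HasCompactSupport u :=
    hM.of_isClosed_subset (isClosed_tsupport _) (husupp.trans hχsupp)
  have huU : tsupport u ⊆ U := (husupp.trans hχsupp).trans hMU
  have huD : ∀ x ∈ c.domain, u x = ρ (c.toFun x) := by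
    intro x hx
    by_cases hxK : x ∈ K
    · simp [u, (hχ1.self_of_nhdsSet) x hxK]
    · have : ρ (c.toFun x) = 0 := image_eq_zero_of_notMem_tsupport fun h => hxK ⟨hx, h⟩
      simp [u, this]
  have hu0 : ∀ x ∈ quadrant (N + 1), x ∉ c.domain → x ∉ tsupport u := fun x hx hxD h =>
    hxD ⟨(huU h).1, hx⟩
  have hleft : c.faceIntegral (fun z => ρ z • f z • dzForm N) =
      ∑ k : Fin (N + 1), (-1 : ℂ) ^ ((k : ℕ) + 1) *
        ∫ y in quadrant N, (fun x => ((u x : ℂ) * f (c.toFun x)) •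
            (dzForm N).compContinuousLinearMap (fderiv ℝ c.toFun x))
          (k.insertNth (α := fun _ => ℝ) 0 y) (fun j => Pi.single (k.succAbove j) (1 : ℝ)) := by
    refine Finset.sum_congr rfl fun k _ => congrArg _ ?_
    have hins : Continuous fun y : Fin N → ℝ => k.insertNth (α := fun _ => ℝ) 0 y := by fun_prop
    have hq : ∀ y : Fin N → ℝ, k.insertNth (α := fun _ => ℝ) 0 y ∈ quadrant (N + 1) ↔
        y ∈ quadrant N := by
      intro y
      simp [quadrant, Fin.forall_iff_succAbove k]
    rw [setIntegral_eq_of_subset_of_forall_sdiff_eq_zero (measurableSet_quadrant N)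
      (s := {y : Fin N → ℝ | k.insertNth (α := fun _ => ℝ) 0 y ∈ c.domain})]
    · refine setIntegral_congr_fun (c.measurableSet_domain.preimage hins.measurable)
        fun y hy => ?_
      simp only [huD _ hy, ContinuousAlternatingMap.smul_apply, smul_eq_mul,
        Complex.real_smul, ContinuousAlternatingMap.compContinuousLinearMap_apply, mul_assoc]
      rfl
    · exact fun y hy => (hq y).1 hy.2
    · intro y hy
      have : u (k.insertNth (α := fun _ => ℝ) 0 y) = 0 :=
        image_eq_zero_of_notMem_tsupport (hu0 _ ((hq y).2 hy.1) hy.2)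
      simp [this]
  rw [hleft, sum_integral_faces_eq_integral_quadrant hU (c.contDiffOn.mono inter_subset_left)
    (fun x hx => hf.differentiableAt (hV.mem_nhds hx.2)) hu huc huU,
    setIntegral_eq_of_subset_of_forall_sdiff_eq_zero (measurableSet_quadrant (N + 1))
      (s := c.domain) inter_subset_right]
  · refine setIntegral_congr_ae c.measurableSet_domain ?_
    filter_upwards [ae_pos_of_mem_quadrant (N + 1)] with x hpos hx
    have hnhds : c.domain ∈ 𝓝 x :=
      Filter.inter_mem (c.isOpen_source.mem_nhds hx.1) (quadrant_mem_nhds (hpos hx.2))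
    have hev : u =ᶠ[𝓝 x] fun y => ρ (c.toFun y) := Filter.mem_of_superset hnhds huD
    have hder : fderiv ℝ u x = (fderiv ℝ ρ (c.toFun x)).comp (fderiv ℝ c.toFun x) := by
      rw [hev.fderiv_eq]
      exact fderiv_comp x (hρ.differentiable (by norm_num) _) (c.differentiableAt hx.1)
    rw [hder, ← ContinuousLinearMap.comp_assoc, wedge_compContinuousLinearMap]
    rfl
  · intro x hx
    rw [fderiv_of_notMem_tsupport ℝ (hu0 x hx.1 hx.2), ContinuousLinearMap.comp_zero,
      wedge_zero_left]
    simp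

lemma integrableOn_pullback_smul_gradForm (c : CornerChart Ω) (hΩ : IsCompact Ω)
    {f : (Fin N → ℂ) → ℂ} (hf : ContinuousOn f Ω) {ρ σ : (Fin N → ℂ) → ℝ} (hρ : ContDiff ℝ 1 ρ)
    (hσ : Continuous σ) {T : Set (Fin N → ℂ)} (hT : IsClosed T) (hTc : T ∩ Ω ⊆ c.image)
    (h0 : ∀ p ∉ T, σ p • gradForm f ρ p = 0) :
    IntegrableOn (fun x => (σ (c.toFun x) • gradForm f ρ (c.toFun x)).compContinuousLinearMap
      (fderiv ℝ c.toFun x) (fun i => Pi.single i (1 : ℝ))) c.domain := by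
  have hK := c.isCompact_domain_inter_preimage hΩ hT hTc
  refine IntegrableOn.of_forall_sdiff_eq_zero
    (s := c.domain ∩ c.toFun ⁻¹' T) (ContinuousOn.integrableOn_compact hK ?_)
    c.measurableSet_domain fun x hx => ?_
  · refine ContinuousOn.mono ?_ inter_subset_left
    have h1 : ContinuousOn c.toFun c.domain := c.contDiffOn.continuousOn.mono inter_subset_left
    have h2 : ContinuousOn (fderiv ℝ c.toFun) c.domain := fun x hx =>
      (((c.contDiffAt hx.1).fderiv_right (m := 1) (by norm_num)).continuousAt).continuousWithinAt
    have h3 : ContinuousOn (fun x => f (c.toFun x)) c.domain := hf.comp h1 c.mapsTo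
    have h4 : ContinuousOn (fun x => (Complex.ofRealCLM.comp
        (fderiv ℝ ρ (c.toFun x))).comp (fderiv ℝ c.toFun x)) c.domain :=
      (continuousOn_const.clm_comp
        ((hρ.continuous_fderiv (by norm_num)).comp_continuousOn h1)).clm_comp h2
    have h5 : ContinuousOn (fun x => σ (c.toFun x)) c.domain := hσ.comp_continuousOn h1
    refine (h5.smul (h3.smul (h4.wedge_compContinuousLinearMap_apply h2 (dzForm N)
      fun i => Pi.single i (1 : ℝ)))).congr fun x _ => ?_
    simp only [Pi.smul_apply', wedge_compContinuousLinearMap]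
    rfl
  · rw [h0 _ fun h => hx.2 ⟨hx.1, h⟩]
    rfl

end CornerChart

/-! ### Partitions of unity -/

/-- The functions `ρ_i` sum to one on `Ω`, so `∑ i, d(ρ_i ∘ φ) = 0` at the interior points of the
domain of a chart `φ`. -/
lemma CornerChart.sum_pullback_gradForm_eq_zero {N : ℕ} {Ω : Set (Fin N → ℂ)} (c : CornerChart Ω)
    {ι : Type*} [Fintype ι] {ρ : ι → (Fin N → ℂ) → ℝ} (hρ : ∀ i, ContDiff ℝ 1 (ρ i))
    (hsum : ∀ p ∈ Ω, ∑ i, ρ i p = 1) (f : (Fin N → ℂ) → ℂ) {x : Fin (N + 1) → ℝ}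
    (hx : x ∈ c.domain) (hpos : ∀ i, 0 < x i) :
    ∑ i, (gradForm f (ρ i) (c.toFun x)).compContinuousLinearMap (fderiv ℝ c.toFun x) = 0 := by
  have hnhds : c.domain ∈ 𝓝 x :=
    Filter.inter_mem (c.isOpen_source.mem_nhds hx.1) (quadrant_mem_nhds hpos)
  have hev : (fun y => ∑ i, ρ i (c.toFun y)) =ᶠ[𝓝 x] fun _ => (1 : ℝ) :=
    Filter.mem_of_superset hnhds fun y hy => hsum _ (c.mapsTo hy)
  have hder : ∑ i, (fderiv ℝ (ρ i) (c.toFun x)).comp (fderiv ℝ c.toFun x) = 0 := by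
    have h1 : HasFDerivAt (fun y => ∑ i, ρ i (c.toFun y))
        (∑ i, (fderiv ℝ (ρ i) (c.toFun x)).comp (fderiv ℝ c.toFun x)) x :=
      HasFDerivAt.fun_sum fun i _ => ((hρ i).differentiable (by norm_num) _).hasFDerivAt.comp x
        (c.differentiableAt hx.1).hasFDerivAt
    rw [← h1.fderiv, hev.fderiv_eq]
    simp
  have h2 : ∀ i, (gradForm f (ρ i) (c.toFun x)).compContinuousLinearMap (fderiv ℝ c.toFun x) =
      f (c.toFun x) • wedge (Complex.ofRealCLM.comp
        ((fderiv ℝ (ρ i) (c.toFun x)).comp (fderiv ℝ c.toFun x)))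
        ((dzForm N).compContinuousLinearMap (fderiv ℝ c.toFun x)) := by
    intro i
    rw [← ContinuousLinearMap.comp_assoc, wedge_compContinuousLinearMap]
    rfl
  simp only [h2]
  rw [← Finset.smul_sum, ← wedge_sum_left, ← ContinuousLinearMap.comp_finsetSum, hder,
    ContinuousLinearMap.comp_zero, wedge_zero_left, smul_zero]

/-- Compactness of `Ω` provides a finite subordinate partition of unity. -/
lemma OrientedAtlas.nonempty_partition {N : ℕ} {Ω : Set (Fin N → ℂ)} (𝒪 : OrientedAtlas Ω)
    (hΩ : IsCompact Ω) : Nonempty 𝒪.Partition := by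
  choose O hO hcO using fun c : 𝒪.charts => c.1.exists_isOpen_image
  obtain ⟨t, ht⟩ := hΩ.elim_finite_subcover O hO fun p hp => by
    obtain ⟨c, hc, hpc⟩ := 𝒪.covers p hp
    exact mem_iUnion.2 ⟨⟨c, hc⟩, (hcO ⟨c, hc⟩ ▸ hpc : p ∈ Ω ∩ O ⟨c, hc⟩).2⟩
  let e := t.equivFin
  obtain ⟨w, hw⟩ := SmoothPartitionOfUnity.exists_isSubordinate 𝓘(ℝ, Fin N → ℂ) hΩ.isClosed
    (fun i => O (e.symm i).1) (fun i => hO _) (by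
      intro p hp
      obtain ⟨c, hct, hpc⟩ := mem_iUnion₂.1 (ht hp)
      exact mem_iUnion.2 ⟨e ⟨c, hct⟩, by simpa using hpc⟩)
  refine ⟨⟨t.card, fun i => (e.symm i).1.1, fun i => (e.symm i).1.2, w, fun i => ?_⟩⟩
  rw [hcO]
  exact fun p hp => ⟨hp.2, hw i hp.1⟩

namespace OrientedAtlas.Partition

variable {N : ℕ} {Ω : Set (Fin N → ℂ)} {𝒪 : OrientedAtlas Ω}

lemma contDiff_weight (P : 𝒪.Partition) (i : Fin P.size) : ContDiff ℝ 1 (P.weight i) :=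
  (P.weight i).contMDiff.contDiff.of_le (by exact_mod_cast le_top)

lemma sum_weight (P : 𝒪.Partition) {p : Fin N → ℂ} (hp : p ∈ Ω) : ∑ i, P.weight i p = 1 := by
  rw [← finsum_eq_sum_of_fintype]
  exact P.weight.sum_eq_one hp

lemma topIntegral_eq_sum (P : 𝒪.Partition) (hΩ : IsCompact Ω) {f : (Fin N → ℂ) → ℂ}
    (hf : ContinuousOn f Ω) (i : Fin P.size) :
    (P.chart i).topIntegral (gradForm f (P.weight i)) =
      ∑ j, (P.chart i).topIntegral (fun p => P.weight j p • gradForm f (P.weight i) p) := by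
  unfold CornerChart.topIntegral
  rw [← integral_finsetSum]
  · refine setIntegral_congr_fun (P.chart i).measurableSet_domain fun x hx => ?_
    simp only [ContinuousAlternatingMap.compContinuousLinearMap_apply,
      ContinuousAlternatingMap.smul_apply]
    rw [← Finset.sum_smul, P.sum_weight ((P.chart i).mapsTo hx), one_smul]
  · intro j _
    exact (P.chart i).integrableOn_pullback_smul_gradForm hΩ hf (P.contDiff_weight i)
      (P.contDiff_weight j).continuous (isClosed_tsupport (P.weight i)) (P.subordinate i)
      fun p hp => by rw [gradForm_eq_zero hp]; ext v; simp

lemma sum_topIntegral_eq_zero (P : 𝒪.Partition) (hΩ : IsCompact Ω) {f : (Fin N → ℂ) → ℂ}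
    (hf : ContinuousOn f Ω) (j : Fin P.size) :
    ∑ i, (P.chart j).topIntegral (fun p => P.weight j p • gradForm f (P.weight i) p) = 0 := by
  unfold CornerChart.topIntegral
  rw [← integral_finsetSum]
  · rw [← integral_zero (Fin (N + 1) → ℝ) ℂ (μ := volume.restrict (P.chart j).domain)]
    refine setIntegral_congr_ae (P.chart j).measurableSet_domain ?_
    filter_upwards [ae_pos_of_mem_quadrant (N + 1)] with x hpos hx
    have h := congrArg (fun η => η fun i => Pi.single i (1 : ℝ))
      ((P.chart j).sum_pullback_gradForm_eq_zero P.contDiff_weight (fun _ => P.sum_weight) f hx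
        (hpos hx.2))
    simp only [ContinuousAlternatingMap.sum_apply,
      ContinuousAlternatingMap.compContinuousLinearMap_apply] at h
    simp only [ContinuousAlternatingMap.compContinuousLinearMap_apply,
      ContinuousAlternatingMap.smul_apply]
    rw [← Finset.smul_sum, h]
    exact smul_zero _
  · intro i _
    exact (P.chart j).integrableOn_pullback_smul_gradForm hΩ hf (P.contDiff_weight i)
      (P.contDiff_weight j).continuous (isClosed_tsupport (P.weight j)) (P.subordinate j)
      fun p hp => by rw [image_eq_zero_of_notMem_tsupport hp]; ext v; simp

theorem boundaryIntegral_eq_zero (P : 𝒪.Partition) (hΩ : IsCompact Ω) {f : (Fin N → ℂ) → ℂ}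
    (hf : HolomorphicOnClosed f Ω) : P.boundaryIntegral (fun z => f z • dzForm N) = 0 := by
  obtain ⟨V, hV, hΩV, hfV⟩ := hf
  have hfΩ : ContinuousOn f Ω := hfV.continuousOn.mono hΩV
  have hchange : ∀ i j,
      (P.chart i).topIntegral (fun p => P.weight j p • gradForm f (P.weight i) p) =
        (P.chart j).topIntegral (fun p => P.weight j p • gradForm f (P.weight i) p) := by
    intro i j
    refine (P.chart i).topIntegral_congr_chart (P.chart j)
      (𝒪.oriented _ (P.chart_mem i) _ (P.chart_mem j)) fun p hp hne => ⟨?_, ?_⟩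
    · refine P.subordinate i ⟨by_contra fun h => hne ?_, hp⟩
      rw [gradForm_eq_zero h]
      ext v
      simp
    · refine P.subordinate j ⟨by_contra fun h => hne ?_, hp⟩
      rw [image_eq_zero_of_notMem_tsupport h]
      ext v
      simp
  calc P.boundaryIntegral (fun z => f z • dzForm N)
      = ∑ i, (P.chart i).topIntegral (gradForm f (P.weight i)) :=
        Finset.sum_congr rfl fun i _ => (P.chart i).faceIntegral_eq_topIntegral hΩ hV hΩV hfV
          (P.contDiff_weight i) (P.subordinate i)
    _ = ∑ i, ∑ j, (P.chart j).topIntegral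
          (fun p => P.weight j p • gradForm f (P.weight i) p) := by
        refine Finset.sum_congr rfl fun i _ => ?_
        rw [P.topIntegral_eq_sum hΩ hfΩ i]
        exact Finset.sum_congr rfl fun j _ => hchange i j
    _ = 0 := by
        rw [Finset.sum_comm]
        exact Finset.sum_eq_zero fun j _ => P.sum_topIntegral_eq_zero hΩ hfΩ j

end OrientedAtlas.Partition

theorem mainTheorem2 (N : ℕ) (Ω : Set (Fin N → ℂ)) (hΩ : IsCompact Ω) (𝒪 : OrientedAtlas Ω)
    (f : (Fin N → ℂ) → ℂ) (hf : HolomorphicOnClosed f Ω) :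
    𝒪.HasBoundaryIntegral (fun z => f z • dzForm N) 0 :=
  ⟨𝒪.nonempty_partition hΩ, fun P => P.boundaryIntegral_eq_zero hΩ hf⟩
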